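/- All Hilbert spaces are finite-dimensional and complex. For a linear map $\mathcal{C}:\mathcal{L}(\mathcal{H}_A)\to\mathcal{L}(\mathcal{H}_B)$ let $\rho^{\mathcal{C}}_{B|A}:=\sum_{i,j}\mathcal{C}(|i\rangle_A\langle j|)\otimes|i\rangle_{A^*}\langle j|$, an operator on $\mathcal{H}_B\otimes\mathcal{H}_A^*$, where $\{|i\rangle_A\}$ is an orthonormal basis of $\mathcal{H}_A$ and $\{|i\rangle_{A^*}\}$ is its dual basis; this Choi–Jamiołkowski operator does not depend on the basis. For a unitary $U$, write $\rho^U$ for the Choi–Jamiołkowski operator of $T\mapsto UTU^\dagger$. A channel (completely positive trace-preserving map) $\mathcal{C}:\mathcal{L}(\mathcal{H}_A)\to\mathcal{L}(\mathcal{H}_B)$ is called a reduced unitary channel if there exist a Hilbert space $\mathcal{H}_F$ and a unitary $U:\mathcal{H}_A\to\mathcal{H}_B\otimes\mathcal{H}_F$ such that $\rho^{\mathcal{C}}_{B|A}=\mathrm{Tr}_F[\rho^U_{BF|A}]$. An operator on $\mathcal{H}_B\otimes\mathcal{H}_A^*$ is said to represent a reduced unitary channel if it is the Choi–Jamiołkowski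 operator of one. Let $\rho_{Y|X}$ be an operator on $\mathcal{H}_Y\otimes\mathcal{H}_X^*$ that represents a reduced unitary channel. (1) Suppose that $\mathcal{H}_X$ has a tensor product structure $\mathcal{H}_X=\mathcal{H}_{X_1}\otimes\mathcal{H}_{X_2}$ with $\mathcal{H}_{X_2}\neq 0$, with respect to which $\rho_{Y|X}=\rho_{Y|X_1}\otimes\mathbb{1}_{X_2^*}$ for some operator $\rho_{Y|X_1}$ on $\mathcal{H}_Y\otimes\mathcal{H}_{X_1}^*$. Then $\rho_{Y|X_1}$ represents a reduced unitary channel. (2) Suppose that $\mathcal{H}_X=\bigoplus_i\mathcal{H}_{X_i}$ is a finite decomposition into orthogonal subspaces and that $\rho_{Y|X}=\bigoplus_i\rho_{Y|X_i}$ for some operators $\rho_{Y|X_i}$ on $\mathcal{H}_Y\otimes\mathcal{H}_{X_i}^*$. Then $\rho_{Y|X_i}$ represents a reduced unitary channel for each $i$. -/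

import Mathlib

open scoped TensorProduct ComplexOrder CStarAlgebra InnerProductSpace

/-- A finite-dimensional complex inner product space is complete, i.e. a Hilbert space. -/
instance finiteDimensionalHilbert_completeSpace (A : Type*) [NormedAddCommGroup A]
    [InnerProductSpace ℂ A] [FiniteDimensional ℂ A] : CompleteSpace A :=
  FiniteDimensional.complete ℂ A

noncomputable section

namespace Quantum

/-- The space `ℒ(A)` of linear operators on `A`. -/
abbrev Op (A : Type*) [AddCommGroup A] [Module ℂ A] : Type _ := A →ₗ[ℂ] A

section Channels

variable {A B : Type*} [NormedAddCommGroup A] [InnerProductSpace ℂ A] [FiniteDimensional ℂ A]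
  [NormedAddCommGroup B] [InnerProductSpace ℂ B] [FiniteDimensional ℂ B]

/-- `C : ℒ(A) → ℒ(B)` is completely positive: it is a completely positive map between the
C⋆-algebras of (automatically bounded) operators on `A` and on `B`. -/
def IsCompletelyPositive (C : Op A →ₗ[ℂ] Op B) : Prop :=
  ∃ Φ : (A →L[ℂ] A) →CP (B →L[ℂ] B),
    ∀ T : A →L[ℂ] A, ((Φ T : B →L[ℂ] B) : Op B) = C (T : Op A)

/-- A quantum channel: a completely positive trace-preserving map. -/
structure IsChannel (C : Op A →ₗ[ℂ] Op B) : Prop where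
  completelyPositive : IsCompletelyPositive C
  tracePreserving : ∀ T : Op A, LinearMap.trace ℂ B (C T) = LinearMap.trace ℂ A T

/-- The operator `|x⟩⟨y|` on `A`. -/
def ketBra (x y : A) : Op A := (InnerProductSpace.rankOne ℂ x y : A →L[ℂ] A)

/-- The vector of the dual space `A*` that corresponds to `x`, i.e. the functional `⟨x|`. For the
members of an orthonormal basis this is the dual basis. -/
def dualVec (x : A) : Module.Dual ℂ A := (innerSL ℂ x : A →L[ℂ] ℂ)

/-- The operator `|x⟩⟨y|` on the dual space `A*`, formed from the dual vectors of `x` and `y`; the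
inner product of `dualVec y` with a functional `φ` is `φ y`. -/
def dualKetBra (x y : A) : Op (Module.Dual ℂ A) :=
  (Module.Dual.eval ℂ A y).smulRight (dualVec x)

/-- The Choi–Jamiołkowski operator `∑ᵢⱼ C(|i⟩⟨j|) ⊗ |i⟩⟨j|` on `B ⊗ A*`, computed in an
orthonormal basis. -/
def cjOfBasis {ι : Type*} [Fintype ι] (b : OrthonormalBasis ι ℂ A) (C : Op A →ₗ[ℂ] Op B) :
    Op (B ⊗[ℂ] Module.Dual ℂ A) :=
  ∑ i, ∑ j, TensorProduct.map (C (ketBra (b i) (b j))) (dualKetBra (b i) (b j))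

/-- The Choi–Jamiołkowski operator of `C`; see `cj_eq_cjOfBasis` for its independence of the
basis. -/
def cj (C : Op A →ₗ[ℂ] Op B) : Op (B ⊗[ℂ] Module.Dual ℂ A) :=
  cjOfBasis (stdOrthonormalBasis ℂ A) C

theorem cjOfBasis_tmul {ι : Type*} [Fintype ι] (b : OrthonormalBasis ι ℂ A)
    (C : Op A →ₗ[ℂ] Op B) (y : B) (φ : Module.Dual ℂ A) :
    cjOfBasis b C (y ⊗ₜ[ℂ] φ) = ∑ i, C (φ.smulRight (b i)) y ⊗ₜ[ℂ] dualVec (b i) := by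
  simp only [cjOfBasis, LinearMap.sum_apply, TensorProduct.map_tmul]
  refine Finset.sum_congr rfl fun i _ => ?_
  have h : φ.smulRight (b i) = ∑ j, φ (b j) • ketBra (b i) (b j) := by
    refine b.toBasis.ext fun k => ?_
    classical
    simp [ketBra, LinearMap.sum_apply, b.inner_eq_ite]
  rw [h, map_sum, LinearMap.sum_apply, TensorProduct.sum_tmul]
  refine Finset.sum_congr rfl fun j _ => ?_
  simp [dualKetBra, TensorProduct.tmul_smul, TensorProduct.smul_tmul]

/-- The Choi–Jamiołkowski operator does not depend on the orthonormal basis. -/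
theorem cj_eq_cjOfBasis {ι : Type*} [Fintype ι] (b : OrthonormalBasis ι ℂ A)
    (C : Op A →ₗ[ℂ] Op B) : cj C = cjOfBasis b C := by
  have key : ∀ {κ : Type _} [Fintype κ] (c : OrthonormalBasis κ ℂ A),
      dualTensorHom ℂ A A (∑ i, dualVec (c i) ⊗ₜ[ℂ] c i) = LinearMap.id := by
    intro κ _ c
    refine c.toBasis.ext fun k => ?_
    classical
    simp [dualVec, c.inner_eq_ite]
  have key' : ∀ {κ : Type _} [Fintype κ] (c : OrthonormalBasis κ ℂ A),
      dualTensorHom ℂ A A (∑ i, dualVec (c i) ⊗ₜ[ℂ] c i) = LinearMap.id := by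
    intro κ _ c
    refine c.toBasis.ext fun k => ?_
    classical
    simp [dualVec, c.inner_eq_ite]
  have hinj := (dualTensorHomEquiv ℂ A A).injective
  have heq : (∑ i, dualVec (stdOrthonormalBasis ℂ A i) ⊗ₜ[ℂ] stdOrthonormalBasis ℂ A i)
      = ∑ i, dualVec (b i) ⊗ₜ[ℂ] b i := by
    apply hinj
    simpa using (key (stdOrthonormalBasis ℂ A)).trans (key' b).symm
  refine TensorProduct.ext' fun y φ => ?_
  rw [cj, cjOfBasis_tmul, cjOfBasis_tmul]
  let L : A →ₗ[ℂ] B := (LinearMap.applyₗ y) ∘ₗ C ∘ₗ LinearMap.smulRightₗ φ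
  have := congrArg (fun t => TensorProduct.comm ℂ _ _ (TensorProduct.map LinearMap.id L t)) heq
  simpa [L] using this

/-- The channel `T ↦ U T U†` of a unitary transformation `U : A → B`; recall `U† = U⁻¹`. -/
def unitaryChannel (U : A ≃ₗᵢ[ℂ] B) : Op A →ₗ[ℂ] Op B :=
  (U.toLinearEquiv.conj : Op A ≃ₗ[ℂ] Op B)

end Channels

section PartialTrace

variable {V F : Type*} [AddCommGroup V] [Module ℂ V] [FiniteDimensional ℂ V]
  [AddCommGroup F] [Module ℂ F] [FiniteDimensional ℂ F]

/-- The partial trace `ℒ(V ⊗ F) → ℒ(V)`, `S ⊗ T ↦ Tr(T) S`. -/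
def partialTrace : Op (V ⊗[ℂ] F) →ₗ[ℂ] Op V :=
  (TensorProduct.rid ℂ (Op V)).toLinearMap ∘ₗ
    TensorProduct.map LinearMap.id (LinearMap.trace ℂ F) ∘ₗ
      (homTensorHomEquiv ℂ V F V F).symm.toLinearMap

theorem partialTrace_map (S : Op V) (T : Op F) :
    partialTrace (TensorProduct.map S T) = LinearMap.trace ℂ F T • S := by
  have h : (homTensorHomEquiv ℂ V F V F).symm (TensorProduct.map S T) = S ⊗ₜ[ℂ] T := by
    rw [LinearEquiv.symm_apply_eq]
    simp [homTensorHomEquiv_apply]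
  simp [partialTrace, h]

end PartialTrace

section ReducedUnitary

variable {A B : Type*} [NormedAddCommGroup A] [InnerProductSpace ℂ A] [FiniteDimensional ℂ A]
  [NormedAddCommGroup B] [InnerProductSpace ℂ B] [FiniteDimensional ℂ B]

/-- `Tr_F` applied to an operator on `(B ⊗ F) ⊗ A*`; the result is an operator on `B ⊗ A*`. -/
def traceOutF {F : Type*} [NormedAddCommGroup F] [InnerProductSpace ℂ F] [FiniteDimensional ℂ F] :
    Op ((B ⊗[ℂ] F) ⊗[ℂ] Module.Dual ℂ A) →ₗ[ℂ] Op (B ⊗[ℂ] Module.Dual ℂ A) :=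
  partialTrace ∘ₗ
    ((TensorProduct.rightComm ℂ B F (Module.Dual ℂ A)).conj :
      Op ((B ⊗[ℂ] F) ⊗[ℂ] Module.Dual ℂ A) ≃ₗ[ℂ] Op ((B ⊗[ℂ] Module.Dual ℂ A) ⊗[ℂ] F)).toLinearMap

/-- A reduced unitary channel: a channel whose Choi–Jamiołkowski operator is `Tr_F` of that of some
unitary `U : A → B ⊗ F`. (Every finite-dimensional Hilbert space `F` is isometric to one in
`Type`.) -/
def IsReducedUnitaryChannel (C : Op A →ₗ[ℂ] Op B) : Prop :=
  IsChannel C ∧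
    ∃ (F : Type) (_ : NormedAddCommGroup F) (_ : InnerProductSpace ℂ F)
      (_ : FiniteDimensional ℂ F) (U : A ≃ₗᵢ[ℂ] B ⊗[ℂ] F),
      cj C = traceOutF (cj (unitaryChannel U))

/-- The operator `ρ` on `B ⊗ A*` is (the Choi–Jamiołkowski operator of) a reduced unitary
channel. -/
def RepresentsReducedUnitaryChannel (ρ : Op (B ⊗[ℂ] Module.Dual ℂ A)) : Prop :=
  ∃ C : Op A →ₗ[ℂ] Op B, IsReducedUnitaryChannel C ∧ cj C = ρ

end ReducedUnitary

section Structures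

variable {X Y : Type*} [NormedAddCommGroup X] [InnerProductSpace ℂ X] [FiniteDimensional ℂ X]
  [NormedAddCommGroup Y] [InnerProductSpace ℂ Y] [FiniteDimensional ℂ Y]

/-- The identification `Y ⊗ X* ≃ (Y ⊗ X₁*) ⊗ X₂*` that a tensor product structure
`S : X ≃ X₁ ⊗ X₂` induces. -/
def splitInput {X₁ X₂ : Type*} [NormedAddCommGroup X₁] [InnerProductSpace ℂ X₁]
    [FiniteDimensional ℂ X₁] [NormedAddCommGroup X₂] [InnerProductSpace ℂ X₂]
    [FiniteDimensional ℂ X₂] (S : X ≃ₗᵢ[ℂ] X₁ ⊗[ℂ] X₂) :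
    Y ⊗[ℂ] Module.Dual ℂ X ≃ₗ[ℂ] (Y ⊗[ℂ] Module.Dual ℂ X₁) ⊗[ℂ] Module.Dual ℂ X₂ :=
  TensorProduct.congr (LinearEquiv.refl ℂ Y)
      (S.toLinearEquiv.dualMap.symm ≪≫ₗ (TensorProduct.dualDistribEquiv ℂ X₁ X₂).symm) ≪≫ₗ
    (TensorProduct.assoc ℂ Y (Module.Dual ℂ X₁) (Module.Dual ℂ X₂)).symm

/-- The operator on `Y ⊗ X*` that acts as `σ` on `Y ⊗ W*` and as zero on the orthogonal complement,
where `W* ⊆ X*` through the orthogonal projection `X → W`. -/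
def extendByZero (W : Submodule ℂ X) (σ : Op (Y ⊗[ℂ] Module.Dual ℂ W)) :
    Op (Y ⊗[ℂ] Module.Dual ℂ X) :=
  TensorProduct.map LinearMap.id
      (W.orthogonalProjectionOnto : X →ₗ[ℂ] W).dualMap ∘ₗ
    σ ∘ₗ TensorProduct.map LinearMap.id W.subtype.dualMap

/-- The direct sum `⨁ᵢ ρᵢ` of operators `ρᵢ` on `Y ⊗ Wᵢ*`, as an operator on `Y ⊗ X*`, for an
orthogonal decomposition `X = ⨁ᵢ Wᵢ`. -/
def directSumOp {ι : Type*} [Fintype ι] (W : ι → Submodule ℂ X)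
    (ρ : ∀ i, Op (Y ⊗[ℂ] Module.Dual ℂ (W i))) : Op (Y ⊗[ℂ] Module.Dual ℂ X) :=
  ∑ i, extendByZero (W i) (ρ i)

end Structures

end Quantum

end

/-! Write `C = Tr_F(U · U†)` for the channel behind `ρ`. Both parts restrict `C` along an isometry
`V`: in (1) `x ↦ x ⊗ e` for a unit vector `e`, followed by the identification with `X`; in (2) the
inclusion of a summand. The form of `ρ` says that `C(|Vx⟩⟨w|)` depends on `⟨w|` only through `⟨w|V`.
So it vanishes for `w` orthogonal to the range of `V`, and `T ↦ C(V T V†)` has the required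
Choi–Jamiołkowski operator (`RepresentsReducedUnitaryChannel.of_contractAt`).

It remains to find a unitary for the restricted channel
(`IsReducedUnitaryChannel.comp_isometryConj`). Let `R` be the range of `UV`. For `r ∈ R` and `w ⊥ R`
the vanishing reads `Tr_F |r⟩⟨w| = 0`, that is, `⟨w|(M ⊗ 1)|r⟩ = 0` for every operator `M` on `B`.
Hence `R` is invariant under all `M ⊗ 1`, so `R = B ⊗ F'` with `F' ⊆ F` (`exists_range_lTensor_eq`),
and `UV` is unitary onto `B ⊗ F'`. On operators supported there, tracing out `F` is the same as
tracing out `F'`. -/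

noncomputable section

namespace Quantum

/-! ### Contractions of Choi–Jamiołkowski operators -/

section Contraction

variable {A B : Type*} [NormedAddCommGroup A] [InnerProductSpace ℂ A]
  [NormedAddCommGroup B] [InnerProductSpace ℂ B]

/-- The contraction `B ⊗ A* → B`, `y ⊗ φ ↦ φ x • y`. -/
def contractAt (B : Type*) [NormedAddCommGroup B] [InnerProductSpace ℂ B] (x : A) :
    B ⊗[ℂ] Module.Dual ℂ A →ₗ[ℂ] B :=
  (TensorProduct.rid ℂ B).toLinearMap ∘ₗ
    TensorProduct.map LinearMap.id (Module.Dual.eval ℂ A x)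

@[simp]
theorem contractAt_tmul (x : A) (y : B) (φ : Module.Dual ℂ A) :
    contractAt B x (y ⊗ₜ[ℂ] φ) = φ x • y := by
  simp [contractAt]

theorem contractAt_zero (s : B ⊗[ℂ] Module.Dual ℂ A) : contractAt B (0 : A) s = 0 := by
  simp [contractAt, TensorProduct.map_zero_right]

theorem contractAt_map_dualMap {A' : Type*} [NormedAddCommGroup A'] [InnerProductSpace ℂ A']
    (f : A →ₗ[ℂ] A') (x : A) (s : B ⊗[ℂ] Module.Dual ℂ A') :
    contractAt B x (TensorProduct.map LinearMap.id f.dualMap s) = contractAt B (f x) s := by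
  induction s with
  | zero => simp
  | add s t hs ht => simp [hs, ht]
  | tmul y φ => simp

variable [FiniteDimensional ℂ A]

/-- An element of `B ⊗ A*` is determined by its contractions with the vectors of `A`. -/
theorem ext_contractAt {s t : B ⊗[ℂ] Module.Dual ℂ A}
    (h : ∀ x, contractAt B x s = contractAt B x t) : s = t := by
  apply (TensorProduct.comm ℂ B (Module.Dual ℂ A)).injective
  apply (dualTensorHomEquiv ℂ A B).injective
  have key : ∀ (x : A) (u : B ⊗[ℂ] Module.Dual ℂ A),
      dualTensorHomEquiv ℂ A B (TensorProduct.comm ℂ B (Module.Dual ℂ A) u) x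
        = contractAt B x u := by
    intro x u
    induction u with
    | zero => simp
    | add s t hs ht => simp only [map_add, LinearMap.add_apply, hs, ht]
    | tmul y φ => simp
  ext x
  rw [key, key, h]

variable [FiniteDimensional ℂ B]

/-- Contracting with `x` turns the sum over the basis into the expansion of `x`. Equations between
Choi–Jamiołkowski operators thus become basis-free equations on operators of rank one. -/
theorem contractAt_cj (C : Op A →ₗ[ℂ] Op B) (x : A) (y : B) (φ : Module.Dual ℂ A) :
    contractAt B x (cj C (y ⊗ₜ[ℂ] φ)) = C (φ.smulRight x) y := by
  have hx := (stdOrthonormalBasis ℂ A).sum_repr' x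
  rw [cj, cjOfBasis_tmul, map_sum]
  let L : A →ₗ[ℂ] B := (LinearMap.applyₗ y) ∘ₗ C ∘ₗ LinearMap.smulRightₗ φ
  have hL := congrArg L hx
  simpa [L, dualVec] using hL

theorem cj_eq_iff (C : Op A →ₗ[ℂ] Op B) (ρ : Op (B ⊗[ℂ] Module.Dual ℂ A)) :
    cj C = ρ ↔ ∀ (φ : Module.Dual ℂ A) (x : A) (y : B),
      C (φ.smulRight x) y = contractAt B x (ρ (y ⊗ₜ[ℂ] φ)) := by
  constructor
  · rintro rfl φ x y
    rw [contractAt_cj]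
  · intro h
    refine TensorProduct.ext' fun y φ => ext_contractAt fun x => ?_
    rw [contractAt_cj, h]

/-- Linear maps out of `ℒ(A)` are determined by their values on operators of rank one. -/
theorem op_hom_ext {M : Type*} [AddCommGroup M] [Module ℂ M] {C D : Op A →ₗ[ℂ] M}
    (h : ∀ (φ : Module.Dual ℂ A) (x : A), C (φ.smulRight x) = D (φ.smulRight x)) : C = D := by
  have key : C ∘ₗ (dualTensorHomEquiv ℂ A A).toLinearMap
      = D ∘ₗ (dualTensorHomEquiv ℂ A A).toLinearMap := by
    refine TensorProduct.ext' fun φ x => ?_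
    have : dualTensorHom ℂ A A (φ ⊗ₜ[ℂ] x) = φ.smulRight x := by
      ext; simp
    simp [this, h]
  ext1 T
  obtain ⟨t, rfl⟩ := (dualTensorHomEquiv ℂ A A).surjective T
  exact LinearMap.congr_fun key t

theorem cj_injective : Function.Injective (cj : (Op A →ₗ[ℂ] Op B) → _) := by
  intro C D h
  refine op_hom_ext fun φ x => LinearMap.ext fun y => ?_
  rw [(cj_eq_iff C _).1 h, contractAt_cj]

end Contraction

/-! ### Partial trace: trace pairing and retracts -/

section PartialTrace

variable {V F : Type*} [AddCommGroup V] [Module ℂ V] [FiniteDimensional ℂ V]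
  [AddCommGroup F] [Module ℂ F] [FiniteDimensional ℂ F]

/-- Linear maps out of `ℒ(V ⊗ F)` are determined by their values on the `S ⊗ T`. -/
theorem op_tensor_hom_ext {M : Type*} [AddCommGroup M] [Module ℂ M]
    {C D : Op (V ⊗[ℂ] F) →ₗ[ℂ] M}
    (h : ∀ (S : Op V) (T : Op F), C (TensorProduct.map S T) = D (TensorProduct.map S T)) :
    C = D := by
  have key : C ∘ₗ (homTensorHomEquiv ℂ V F V F).toLinearMap
      = D ∘ₗ (homTensorHomEquiv ℂ V F V F).toLinearMap := by
    refine TensorProduct.ext' fun S T => ?_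
    simpa [homTensorHomEquiv_apply] using h S T
  ext1 T
  obtain ⟨t, rfl⟩ := (homTensorHomEquiv ℂ V F V F).surjective T
  exact LinearMap.congr_fun key t

/-- Both sides are linear in `S`, and on product operators the trace factorizes. This duality with
`M ↦ M ⊗ 1` turns a vanishing partial trace into orthogonality relations. -/
theorem trace_comp_partialTrace (M : Op V) (S : Op (V ⊗[ℂ] F)) :
    LinearMap.trace ℂ V (M ∘ₗ partialTrace S)
      = LinearMap.trace ℂ (V ⊗[ℂ] F) (TensorProduct.map M LinearMap.id ∘ₗ S) := by
  have key : LinearMap.trace ℂ V ∘ₗ LinearMap.mulLeft ℂ M ∘ₗ partialTrace (F := F)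
      = LinearMap.trace ℂ (V ⊗[ℂ] F) ∘ₗ
        LinearMap.mulLeft ℂ (TensorProduct.map M LinearMap.id : Op (V ⊗[ℂ] F)) := by
    refine op_tensor_hom_ext fun S T => ?_
    simp only [LinearMap.comp_apply, LinearMap.mulLeft_apply, partialTrace_map,
      Module.End.mul_eq_comp, ← TensorProduct.map_comp,
      LinearMap.trace_tensorProduct', LinearMap.id_comp, map_smul,
      smul_eq_mul]
    ring
  exact LinearMap.congr_fun key S

/-- The partial trace over `F` restricts to the partial trace over a retract `F'` of `F`. -/
theorem partialTrace_conj_retract {F' : Type*} [AddCommGroup F'] [Module ℂ F']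
    [FiniteDimensional ℂ F'] (f : F' →ₗ[ℂ] F) (g : F →ₗ[ℂ] F') (hgf : g ∘ₗ f = LinearMap.id)
    (S : Op (V ⊗[ℂ] F')) :
    partialTrace (TensorProduct.map LinearMap.id f ∘ₗ S ∘ₗ TensorProduct.map LinearMap.id g)
      = partialTrace S := by
  have key : partialTrace ∘ₗ
      LinearMap.llcomp ℂ _ _ _ (TensorProduct.map LinearMap.id f : V ⊗[ℂ] F' →ₗ[ℂ] V ⊗[ℂ] F) ∘ₗ
      LinearMap.lcomp ℂ _ (TensorProduct.map LinearMap.id g : V ⊗[ℂ] F →ₗ[ℂ] V ⊗[ℂ] F')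
      = partialTrace := by
    refine op_tensor_hom_ext fun S T => ?_
    have h : LinearMap.trace ℂ F (f ∘ₗ T ∘ₗ g) = LinearMap.trace ℂ F' T := by
      rw [LinearMap.trace_comp_comm', LinearMap.comp_assoc, hgf, LinearMap.comp_id]
    have e : (LinearMap.llcomp ℂ _ _ _
        (TensorProduct.map LinearMap.id f : V ⊗[ℂ] F' →ₗ[ℂ] V ⊗[ℂ] F) ∘ₗ
      LinearMap.lcomp ℂ _ (TensorProduct.map LinearMap.id g : V ⊗[ℂ] F →ₗ[ℂ] V ⊗[ℂ] F'))
        (TensorProduct.map S T) = TensorProduct.map S (f ∘ₗ T ∘ₗ g) :=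
      TensorProduct.ext' fun _ _ => by simp
    rw [LinearMap.comp_apply, e, partialTrace_map, partialTrace_map, h]
  exact LinearMap.congr_fun key S

end PartialTrace

/-! ### Partial trace of Choi–Jamiołkowski operators -/

section ReducedUnitary

variable {A B : Type*} [NormedAddCommGroup A] [InnerProductSpace ℂ A] [FiniteDimensional ℂ A]
  [NormedAddCommGroup B] [InnerProductSpace ℂ B] [FiniteDimensional ℂ B]
  {F : Type*} [NormedAddCommGroup F] [InnerProductSpace ℂ F] [FiniteDimensional ℂ F]

theorem traceOutF_map (S : Op (B ⊗[ℂ] F)) (T : Op (Module.Dual ℂ A)) :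
    traceOutF (TensorProduct.map S T) = TensorProduct.map (partialTrace S) T := by
  have key : traceOutF ∘ₗ (TensorProduct.mapBilinear (RingHom.id ℂ) (B ⊗[ℂ] F)
      (Module.Dual ℂ A) (B ⊗[ℂ] F) (Module.Dual ℂ A)).flip T
      = (TensorProduct.mapBilinear (RingHom.id ℂ) B (Module.Dual ℂ A) B
        (Module.Dual ℂ A)).flip T ∘ₗ partialTrace := by
    refine op_tensor_hom_ext fun S₁ S₂ => ?_
    have e : (TensorProduct.rightComm ℂ B F (Module.Dual ℂ A)).conj
        (TensorProduct.map (TensorProduct.map S₁ S₂) T)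
        = TensorProduct.map (TensorProduct.map S₁ T) S₂ :=
      TensorProduct.ext_threefold fun _ _ _ => by simp [LinearEquiv.conj_apply]
    simp only [LinearMap.comp_apply, LinearMap.flip_apply, TensorProduct.mapBilinear_apply,
      traceOutF, LinearEquiv.coe_coe, e, partialTrace_map, TensorProduct.map_smul_left]
  exact LinearMap.congr_fun key S

theorem traceOutF_cj (D : Op A →ₗ[ℂ] Op (B ⊗[ℂ] F)) :
    traceOutF (cj D) = cj (partialTrace ∘ₗ D) := by
  simp only [cj, cjOfBasis, map_sum, traceOutF_map, LinearMap.comp_apply]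

theorem cj_eq_traceOutF_cj_iff (C : Op A →ₗ[ℂ] Op B) (D : Op A →ₗ[ℂ] Op (B ⊗[ℂ] F)) :
    cj C = traceOutF (cj D) ↔ C = partialTrace ∘ₗ D := by
  rw [traceOutF_cj, cj_injective.eq_iff]

end ReducedUnitary

/-! ### Restriction of a reduced unitary channel along an isometry -/

section Compression

variable {A A' B : Type*} [NormedAddCommGroup A] [InnerProductSpace ℂ A] [FiniteDimensional ℂ A]
  [NormedAddCommGroup A'] [InnerProductSpace ℂ A'] [FiniteDimensional ℂ A']
  [NormedAddCommGroup B] [InnerProductSpace ℂ B] [FiniteDimensional ℂ B]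

theorem adjoint_comp_linearIsometry (V : A' →ₗᵢ[ℂ] A) :
    LinearMap.adjoint V.toLinearMap ∘ₗ V.toLinearMap = LinearMap.id := by
  refine LinearMap.ext fun x => ext_inner_right ℂ fun y => ?_
  simp

/-- The map `T ↦ V T V†` of an isometry `V`. -/
def isometryConj (V : A' →ₗᵢ[ℂ] A) : Op A' →ₗ[ℂ] Op A where
  toFun T := V.toLinearMap ∘ₗ T ∘ₗ LinearMap.adjoint V.toLinearMap
  map_add' S T := by rw [LinearMap.add_comp, LinearMap.comp_add]
  map_smul' c T := by rw [LinearMap.smul_comp, LinearMap.comp_smul]; rfl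

theorem isometryConj_apply (V : A' →ₗᵢ[ℂ] A) (T : Op A') :
    isometryConj V T = V.toLinearMap ∘ₗ T ∘ₗ LinearMap.adjoint V.toLinearMap := rfl

theorem isometryConj_smulRight (V : A' →ₗᵢ[ℂ] A) (φ : Module.Dual ℂ A') (x : A') :
    isometryConj V (φ.smulRight x)
      = (φ ∘ₗ LinearMap.adjoint V.toLinearMap).smulRight (V x) := by
  ext y
  simp [isometryConj_apply]

/-- Conjugation by an isometry, as a homomorphism of C⋆-algebras. -/
def isometryConjHom (V : A' →ₗᵢ[ℂ] A) : (A' →L[ℂ] A') →⋆ₙₐ[ℂ] (A →L[ℂ] A) where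
  toFun T := V.toContinuousLinearMap ∘L T ∘L
    ContinuousLinearMap.adjoint V.toContinuousLinearMap
  map_smul' c T := by ext; simp
  map_zero' := by ext; simp
  map_add' S T := by ext; simp
  map_mul' S T := by
    have h (z : A') : ContinuousLinearMap.adjoint V.toContinuousLinearMap (V z) = z :=
      LinearMap.congr_fun (adjoint_comp_linearIsometry V) z
    ext x
    simp [h]
  map_star' T := by
    simp [ContinuousLinearMap.star_eq_adjoint, ContinuousLinearMap.adjoint_comp,
      ContinuousLinearMap.comp_assoc]

/-- Since `V†V = 1`, conjugation by `V` is a (possibly non-unital) star-homomorphism, hence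
completely positive, and it preserves the trace by cyclicity. -/
theorem IsChannel.comp_isometryConj {C : Op A →ₗ[ℂ] Op B} (hC : IsChannel C) (V : A' →ₗᵢ[ℂ] A) :
    IsChannel (C ∘ₗ isometryConj V) where
  completelyPositive := by
    obtain ⟨Φ, hΦ⟩ := hC.completelyPositive
    refine ⟨⟨(Φ : (A →L[ℂ] A) →ₗ[ℂ] (B →L[ℂ] B)) ∘ₗ
      (isometryConjHom V : (A' →L[ℂ] A') →ₗ[ℂ] (A →L[ℂ] A)), fun k M hM => ?_⟩, fun T => ?_⟩
    · exact CompletelyPositiveMapClass.map_cstarMatrix_nonneg' Φ k _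
        (CompletelyPositiveMapClass.map_cstarMatrix_nonneg' (isometryConjHom V) k M hM)
    · exact hΦ (isometryConjHom V T)
  tracePreserving T := by
    rw [LinearMap.comp_apply, hC.tracePreserving, isometryConj_apply, LinearMap.trace_comp_comm',
      LinearMap.comp_assoc, adjoint_comp_linearIsometry, LinearMap.comp_id]

/-- A subspace of `B ⊗ F` that is invariant under all `M ⊗ 1` is of the form `B ⊗ F'`. -/
theorem exists_range_lTensor_eq {F : Type*} [NormedAddCommGroup F] [InnerProductSpace ℂ F]
    [FiniteDimensional ℂ F] (R : Submodule ℂ (B ⊗[ℂ] F))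
    (hR : ∀ (M : Op B), ∀ r ∈ R, TensorProduct.map M LinearMap.id r ∈ R) :
    ∃ F' : Submodule ℂ F,
      LinearMap.range (F'.subtypeₗᵢ.lTensor B).toLinearMap = R := by
  -- `F'` consists of the `f` with `y ⊗ f ∈ R` for every `y`.
  refine ⟨⨅ y : B, R.comap (TensorProduct.mk ℂ B F y), le_antisymm ?_ fun r hr => ?_⟩
  · rintro _ ⟨t, rfl⟩
    induction t with
    | zero => simp
    | add s t hs ht => simpa using R.add_mem hs ht
    | tmul y f =>
      have := (Submodule.mem_iInf _).1 f.2 y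
      simpa using this
  · let b := stdOrthonormalBasis ℂ B
    let slice (i : Fin (Module.finrank ℂ B)) : B ⊗[ℂ] F →ₗ[ℂ] F :=
      (TensorProduct.lid ℂ F).toLinearMap ∘ₗ
        TensorProduct.map (dualVec (b i) : B →ₗ[ℂ] ℂ) LinearMap.id
    -- Tensoring the `i`-th coordinate with `y` amounts to applying `|y⟩⟨b i| ⊗ 1`, so invariance of
    -- `R` puts the coordinates of `r ∈ R` into `F'`.
    have hslice : ∀ (i) (y : B) (t : B ⊗[ℂ] F), y ⊗ₜ[ℂ] slice i t
        = TensorProduct.map ((dualVec (b i)).smulRight y) LinearMap.id t := by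
      intro i y t
      induction t with
      | zero => simp
      | add s t hs ht => simp only [map_add, TensorProduct.tmul_add, hs, ht]
      | tmul z f => simp [slice, TensorProduct.smul_tmul]
    have hsum : ∀ t : B ⊗[ℂ] F, t = ∑ i, b i ⊗ₜ[ℂ] slice i t := by
      intro t
      induction t with
      | zero => simp
      | add s t hs ht =>
        simp only [map_add, TensorProduct.tmul_add, Finset.sum_add_distrib, ← hs, ← ht]
      | tmul z f =>
        conv_lhs => rw [← b.sum_repr' z, TensorProduct.sum_tmul]
        simp [slice, dualVec, TensorProduct.smul_tmul]
    rw [hsum r]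
    refine Submodule.sum_mem _ fun i _ => ?_
    refine ⟨b i ⊗ₜ[ℂ] (⟨slice i r, (Submodule.mem_iInf _).2 fun y => ?_⟩ :
      (⨅ y : B, R.comap (TensorProduct.mk ℂ B F y) : Submodule ℂ F)), by simp⟩
    rw [Submodule.mem_comap, TensorProduct.mk_apply, hslice]
    exact hR _ _ hr

/-- Two isometries with the same range differ by a unitary. -/
theorem exists_linearIsometryEquiv_of_range_eq {E₁ E₂ E : Type*}
    [NormedAddCommGroup E₁] [InnerProductSpace ℂ E₁] [NormedAddCommGroup E₂]
    [InnerProductSpace ℂ E₂] [NormedAddCommGroup E] [InnerProductSpace ℂ E]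
    (f : E₁ →ₗᵢ[ℂ] E) (g : E₂ →ₗᵢ[ℂ] E)
    (h : LinearMap.range g.toLinearMap = LinearMap.range f.toLinearMap) :
    ∃ e : E₁ ≃ₗᵢ[ℂ] E₂, ∀ x, g (e x) = f x := by
  let e : E₁ ≃ₗᵢ[ℂ] E₂ := f.equivRange.trans
    ((LinearIsometryEquiv.ofEq _ _ h.symm).trans g.equivRange.symm)
  refine ⟨e, fun x => ?_⟩
  have h1 : g.equivRange (e x) = LinearIsometryEquiv.ofEq _ _ h.symm (f.equivRange x) := by
    simp [e]
  exact congrArg Subtype.val h1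

theorem unitaryChannel_eq_isometryConj (U : A ≃ₗᵢ[ℂ] B) :
    unitaryChannel U = isometryConj U.toLinearIsometry := by
  refine LinearMap.ext fun T => LinearMap.ext fun y => ?_
  have h : LinearMap.adjoint U.toLinearIsometry.toLinearMap y = U.symm y := by
    refine ext_inner_right ℂ fun x => ?_
    rw [LinearMap.adjoint_inner_left]
    simpa using (U.inner_map_map (U.symm y) x)
  simp [unitaryChannel, isometryConj_apply, LinearEquiv.conj_apply, h]

theorem isometryConj_comp {A'' : Type*} [NormedAddCommGroup A''] [InnerProductSpace ℂ A'']
    [FiniteDimensional ℂ A''] (V : A' →ₗᵢ[ℂ] A) (W : A'' →ₗᵢ[ℂ] A') :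
    isometryConj V ∘ₗ isometryConj W = isometryConj (V.comp W) := by
  refine LinearMap.ext fun T => ?_
  have h : (V.comp W).toLinearMap = V.toLinearMap ∘ₗ W.toLinearMap := rfl
  simp only [LinearMap.comp_apply, isometryConj_apply, h, LinearMap.adjoint_comp,
    LinearMap.comp_assoc]

/-- A reduced unitary channel stays one when it is restricted along an isometry `V`, provided that
it kills all `|v⟩⟨w|` with `v` in the range of `V` and `w` orthogonal to that range. -/
theorem IsReducedUnitaryChannel.comp_isometryConj {C : Op A →ₗ[ℂ] Op B}
    (hC : IsReducedUnitaryChannel C) (V : A' →ₗᵢ[ℂ] A)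
    (hV : ∀ (φ : Module.Dual ℂ A) (x : A'), φ ∘ₗ V.toLinearMap = 0 →
      C (φ.smulRight (V x)) = 0) :
    IsReducedUnitaryChannel (C ∘ₗ isometryConj V) := by
  obtain ⟨hch, F, i₁, i₂, i₃, U, hU⟩ := hC
  refine ⟨hch.comp_isometryConj V, ?_⟩
  rw [cj_eq_traceOutF_cj_iff] at hU
  let Z : A' →ₗᵢ[ℂ] B ⊗[ℂ] F := U.toLinearIsometry.comp V
  obtain ⟨F', hF'⟩ := exists_range_lTensor_eq (LinearMap.range Z.toLinearMap) (by
    rintro M _ ⟨x, rfl⟩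
    -- It suffices to test `(M ⊗ 1) Z x` against every `w` orthogonal to the range of `Z`.
    rw [← Submodule.orthogonal_orthogonal (LinearMap.range Z.toLinearMap)]
    refine (Submodule.mem_orthogonal _ _).2 fun w hw => ?_
    let φ : Module.Dual ℂ A := dualVec (U.symm w)
    have hφ : φ ∘ₗ V.toLinearMap = 0 := by
      refine LinearMap.ext fun x' => ?_
      have := (Submodule.mem_orthogonal' _ _).1 hw (Z x') ⟨x', rfl⟩
      have h2 := U.inner_map_map (U.symm w) (V x')
      simp only [LinearIsometryEquiv.apply_symm_apply] at h2
      change ⟪U.symm w, V x'⟫_ℂ = 0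
      rw [← h2]
      exact this
    have h0 := hV φ x hφ
    have h1 : unitaryChannel U (φ.smulRight (V x)) = (dualVec w).smulRight (Z x) := by
      refine LinearMap.ext fun t => ?_
      have h2 := U.inner_map_map (U.symm w) (U.symm t)
      simp only [LinearIsometryEquiv.apply_symm_apply] at h2
      change U (⟪U.symm w, U.symm t⟫_ℂ • V x) = ⟪w, t⟫_ℂ • U (V x)
      rw [map_smul, h2]
    rw [hU, LinearMap.comp_apply, h1] at h0
    -- The left side vanishes by `h0`; the right side is `⟨w, (M ⊗ 1) Z x⟩`.
    have h3 := trace_comp_partialTrace M ((dualVec w).smulRight (Z x))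
    have h4 : TensorProduct.map M LinearMap.id ∘ₗ (dualVec w).smulRight (Z x)
        = (dualVec w).smulRight (TensorProduct.map M LinearMap.id (Z x)) := by
      refine LinearMap.ext fun t => by simp
    rw [h0, h4, LinearMap.trace_smulRight] at h3
    simpa [dualVec] using h3.symm)
  let J : B ⊗[ℂ] F' →ₗᵢ[ℂ] B ⊗[ℂ] F := F'.subtypeₗᵢ.lTensor B
  obtain ⟨U', hU'⟩ := exists_linearIsometryEquiv_of_range_eq Z J (by exact hF')
  refine ⟨F', inferInstance, inferInstance, inferInstance, U', ?_⟩
  rw [cj_eq_traceOutF_cj_iff, hU, LinearMap.comp_assoc, unitaryChannel_eq_isometryConj,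
    unitaryChannel_eq_isometryConj, isometryConj_comp]
  have hZ : U.toLinearIsometry.comp V = J.comp U'.toLinearIsometry :=
    LinearIsometry.ext fun x => (hU' x).symm
  have hconj : isometryConj (J.comp U'.toLinearIsometry)
      = isometryConj J ∘ₗ isometryConj U'.toLinearIsometry := (isometryConj_comp _ _).symm
  rw [hZ, hconj, ← LinearMap.comp_assoc]
  congr 1
  refine LinearMap.ext fun S => ?_
  -- `J` acts on the second factor only, and there the adjoint of the inclusion is a left inverse of
  -- it.
  have hJ : J.toLinearMap = TensorProduct.map LinearMap.id F'.subtypeₗᵢ.toLinearMap := by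
    refine TensorProduct.ext' fun y f => by simp [J]
  rw [LinearMap.comp_apply, isometryConj_apply, hJ, TensorProduct.adjoint_map,
    LinearMap.adjoint_id]
  exact partialTrace_conj_retract _ _ (adjoint_comp_linearIsometry _) S

/-- The right side of `h` sees `φ` only through `φ ∘ V`. With `φ ∘ V = 0` it gives the vanishing
needed for restriction; with `φ ∘ V†` in place of `φ`, and `V†V = 1`, it identifies the restricted
operator as `ρ`. -/
theorem RepresentsReducedUnitaryChannel.of_contractAt {C : Op A →ₗ[ℂ] Op B}
    (hC : IsReducedUnitaryChannel C) (V : A' →ₗᵢ[ℂ] A) {ρ : Op (B ⊗[ℂ] Module.Dual ℂ A')}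
    (h : ∀ (φ : Module.Dual ℂ A) (x : A') (y : B),
      C (φ.smulRight (V x)) y = contractAt B x (ρ (y ⊗ₜ[ℂ] (φ ∘ₗ V.toLinearMap)))) :
    RepresentsReducedUnitaryChannel ρ := by
  refine ⟨C ∘ₗ isometryConj V, hC.comp_isometryConj V fun φ x hφ => ?_, ?_⟩
  · refine LinearMap.ext fun y => ?_
    rw [h, hφ]
    simp
  · rw [cj_eq_iff]
    intro φ x y
    rw [LinearMap.comp_apply, isometryConj_smulRight, h, LinearMap.comp_assoc,
      adjoint_comp_linearIsometry, LinearMap.comp_id]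

end Compression

/-! ### Contractions for tensor products and direct sums -/

section Structures

variable {X Y : Type*} [NormedAddCommGroup X] [InnerProductSpace ℂ X]
  [NormedAddCommGroup Y] [InnerProductSpace ℂ Y]
  {X₁ X₂ : Type*} [NormedAddCommGroup X₁] [InnerProductSpace ℂ X₁]
  [FiniteDimensional ℂ X₁] [NormedAddCommGroup X₂] [InnerProductSpace ℂ X₂]
  [FiniteDimensional ℂ X₂]

theorem contractAt_splitInput_symm (S : X ≃ₗᵢ[ℂ] X₁ ⊗[ℂ] X₂) (x₁ : X₁) (x₂ : X₂)
    (s : Y ⊗[ℂ] Module.Dual ℂ X₁) (φ₂ : Module.Dual ℂ X₂) :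
    contractAt Y (S.symm (x₁ ⊗ₜ[ℂ] x₂)) ((splitInput S).symm (s ⊗ₜ[ℂ] φ₂))
      = φ₂ x₂ • contractAt Y x₁ s := by
  induction s with
  | zero => simp
  | add s t hs ht => simp only [TensorProduct.add_tmul, map_add, hs, ht, smul_add]
  | tmul y φ₁ =>
    simp [splitInput, TensorProduct.dualDistribEquiv, smul_smul, mul_comm]

/-- The isometry `x₁ ↦ x₁ ⊗ e` for a unit vector `e`. -/
def tmulUnit (X₁ : Type*) [NormedAddCommGroup X₁] [InnerProductSpace ℂ X₁] (e : X₂)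
    (he : ‖e‖ = 1) : X₁ →ₗᵢ[ℂ] X₁ ⊗[ℂ] X₂ where
  toLinearMap := (TensorProduct.mk ℂ X₁ X₂).flip e
  norm_map' x := by simp [he]

theorem contractAt_of_splitInput_conj (S : X ≃ₗᵢ[ℂ] X₁ ⊗[ℂ] X₂)
    {ρ : Op (Y ⊗[ℂ] Module.Dual ℂ X)} {ρ₁ : Op (Y ⊗[ℂ] Module.Dual ℂ X₁)}
    (h : (splitInput S).conj ρ = TensorProduct.map ρ₁ (LinearMap.id : Op (Module.Dual ℂ X₂)))
    (e : X₂) (x : X₁) (y : Y) (φ : Module.Dual ℂ X) :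
    contractAt Y (S.symm (x ⊗ₜ[ℂ] e)) (ρ (y ⊗ₜ[ℂ] φ))
      = contractAt Y x (ρ₁ (y ⊗ₜ[ℂ]
          (φ ∘ₗ S.symm.toLinearEquiv.toLinearMap ∘ₗ (TensorProduct.mk ℂ X₁ X₂).flip e))) := by
  obtain ⟨t, rfl⟩ := ((TensorProduct.dualDistribEquiv ℂ X₁ X₂).trans
    S.toLinearEquiv.dualMap).surjective φ
  induction t with
  | zero => simp
  | add s t hs ht =>
    simp only [map_add, TensorProduct.tmul_add, hs, ht, LinearMap.add_comp]
  | tmul φ₁ φ₂ =>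
    have h1 : y ⊗ₜ[ℂ] ((TensorProduct.dualDistribEquiv ℂ X₁ X₂).trans
        S.toLinearEquiv.dualMap) (φ₁ ⊗ₜ[ℂ] φ₂)
        = (splitInput S).symm ((y ⊗ₜ[ℂ] φ₁) ⊗ₜ[ℂ] φ₂) := by
      simp [splitInput]
    have h2 := LinearMap.congr_fun h ((y ⊗ₜ[ℂ] φ₁) ⊗ₜ[ℂ] φ₂)
    rw [LinearEquiv.conj_apply_apply, ← LinearEquiv.eq_symm_apply, TensorProduct.map_tmul] at h2
    -- Restricting `φ₁ ⊗ φ₂` along `z ↦ z ⊗ e` yields the factor `φ₂ e`, the same one that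
    -- contracting the identity factor at `e` yields.
    have h3 : ((TensorProduct.dualDistribEquiv ℂ X₁ X₂).trans
        S.toLinearEquiv.dualMap) (φ₁ ⊗ₜ[ℂ] φ₂) ∘ₗ S.symm.toLinearEquiv.toLinearMap ∘ₗ
          (TensorProduct.mk ℂ X₁ X₂).flip e = φ₂ e • φ₁ := by
      refine LinearMap.ext fun z => ?_
      simp [TensorProduct.dualDistribEquiv, mul_comm]
    rw [h1, h2, LinearMap.id_apply, contractAt_splitInput_symm, h3]
    simp

variable [FiniteDimensional ℂ X]

theorem contractAt_extendByZero (W : Submodule ℂ X) (σ : Op (Y ⊗[ℂ] Module.Dual ℂ W)) (x : X)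
    (y : Y) (φ : Module.Dual ℂ X) :
    contractAt Y x (extendByZero W σ (y ⊗ₜ[ℂ] φ))
      = contractAt Y (W.orthogonalProjectionOnto x) (σ (y ⊗ₜ[ℂ] (φ ∘ₗ W.subtype))) := by
  simp only [extendByZero, LinearMap.comp_apply, contractAt_map_dualMap, TensorProduct.map_tmul]
  rfl

theorem contractAt_directSumOp {ι : Type*} [Fintype ι] {W : ι → Submodule ℂ X}
    (hW : OrthogonalFamily ℂ (fun i => W i) (fun i => (W i).subtypeₗᵢ))
    (ρ : ∀ i, Op (Y ⊗[ℂ] Module.Dual ℂ (W i))) (i : ι) (x : W i) (y : Y) (φ : Module.Dual ℂ X) :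
    contractAt Y (x : X) (directSumOp W ρ (y ⊗ₜ[ℂ] φ))
      = contractAt Y x (ρ i (y ⊗ₜ[ℂ] (φ ∘ₗ (W i).subtype))) := by
  rw [directSumOp, LinearMap.sum_apply, map_sum, Finset.sum_eq_single i]
  · rw [contractAt_extendByZero]
    simp
  · intro j _ hj
    -- The other summands drop out because `x ∈ W i` is orthogonal to `W j`.
    have : (W j).orthogonalProjectionOnto (x : X) = 0 := by
      rw [Submodule.orthogonalProjectionOnto_eq_zero_iff, Submodule.mem_orthogonal]
      intro u hu
      exact hW hj ⟨u, hu⟩ x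
    rw [contractAt_extendByZero, this, contractAt_zero]
  · simp

end Structures

end Quantum

end

theorem lemma2 {X Y : Type*}
    [NormedAddCommGroup X] [InnerProductSpace ℂ X] [FiniteDimensional ℂ X]
    [NormedAddCommGroup Y] [InnerProductSpace ℂ Y] [FiniteDimensional ℂ Y]
    (ρ : Quantum.Op (Y ⊗[ℂ] Module.Dual ℂ X))
    (hρ : Quantum.RepresentsReducedUnitaryChannel ρ) :
    (∀ (X₁ X₂ : Type*)
        [NormedAddCommGroup X₁] [InnerProductSpace ℂ X₁] [FiniteDimensional ℂ X₁]
        [NormedAddCommGroup X₂] [InnerProductSpace ℂ X₂] [FiniteDimensional ℂ X₂]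
        [Nontrivial X₂]
        (S : X ≃ₗᵢ[ℂ] X₁ ⊗[ℂ] X₂) (ρ₁ : Quantum.Op (Y ⊗[ℂ] Module.Dual ℂ X₁)),
        (Quantum.splitInput S).conj ρ
            = TensorProduct.map ρ₁ (LinearMap.id : Quantum.Op (Module.Dual ℂ X₂)) →
          Quantum.RepresentsReducedUnitaryChannel ρ₁) ∧
    (∀ (ι : Type*) [Fintype ι] [DecidableEq ι] (W : ι → Submodule ℂ X),
        OrthogonalFamily ℂ (fun i => W i) (fun i => (W i).subtypeₗᵢ) →
        DirectSum.IsInternal W →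
        ∀ ρ' : ∀ i, Quantum.Op (Y ⊗[ℂ] Module.Dual ℂ (W i)),
          ρ = Quantum.directSumOp W ρ' →
            ∀ i, Quantum.RepresentsReducedUnitaryChannel (ρ' i)) := by
  obtain ⟨C, hC, hCρ⟩ := hρ
  rw [Quantum.cj_eq_iff] at hCρ
  refine ⟨?_, ?_⟩
  · intro X₁ X₂ _ _ _ _ _ _ _ S ρ₁ h
    -- `X₂ ≠ 0` provides a unit vector, and any one will do.
    obtain ⟨e, he⟩ := exists_norm_eq X₂ zero_le_one
    refine Quantum.RepresentsReducedUnitaryChannel.of_contractAt hC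
      (S.symm.toLinearIsometry.comp (Quantum.tmulUnit X₁ e he)) fun φ x y => ?_
    rw [hCρ]
    exact Quantum.contractAt_of_splitInput_conj S h e x y φ
  · intro ι _ _ W hW _ ρ' h i
    refine Quantum.RepresentsReducedUnitaryChannel.of_contractAt hC (W i).subtypeₗᵢ
      fun φ x y => ?_
    rw [hCρ, h]
    exact Quantum.contractAt_directSumOp hW ρ' i x y φ
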